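/- A saturated measurable space with negligibles (saturated MSN) is a triple $(X,\mathscr{A},\mathscr{N})$ where $\mathscr{A}$ is a $\sigma$-algebra on the set $X$ and $\mathscr{N}\subset\mathscr{A}$ is a $\sigma$-ideal such that every subset of a member of $\mathscr{N}$ belongs to $\mathscr{N}$. An $\mathscr{N}$-essential supremum of $\mathscr{F}\subset\mathscr{A}$ is a set $S\in\mathscr{A}$ such that $F\setminus S\in\mathscr{N}$ for all $F\in\mathscr{F}$, and such that $S\setminus B\in\mathscr{N}$ whenever $B\in\mathscr{A}$ satisfies $F\setminus B\in\mathscr{N}$ for all $F\in\mathscr{F}$. A family $\mathscr{E}\subset\mathscr{A}$ is $\mathscr{N}$-generating if $X$ is an $\mathscr{N}$-essential supremum of $\mathscr{E}$. A saturated MSN is localizable if every $\mathscr{F}\subset\mathscr{A}$ has an $\mathscr{N}$-essential supremum; it is locally determined if, for every $\mathscr{N}$-generating $\mathscr{E}$ and every $A\subset X$, $A\cap E\in\mathscr{A}$ for all $E\in\mathscr{E}$ implies $A\in\mathscr{A}$; it is lld if it is localizable and locally determined; it is ccc if every family $\mathscr{F}\subset\mathscr{A}\setminus\mathscr{N}$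 whose distinct members have pairwise intersections in $\mathscr{N}$ is countable. Let $\mathsf{MSN_{sp}}$ be the category whose objects are the saturated MSNs and whose morphisms $(X,\mathscr{A},\mathscr{N})\to(Y,\mathscr{B},\mathscr{M})$ are the equivalence classes, modulo $f\sim g\iff\{f\neq g\}\in\mathscr{N}$, of maps $f:X\to Y$ such that $f^{-1}(B)\in\mathscr{A}$ for $B\in\mathscr{B}$, $f^{-1}(M)\in\mathscr{N}$ for $M\in\mathscr{M}$, and such that $f$ is supremum preserving: whenever $S$ is an $\mathscr{M}$-essential supremum of $\mathscr{F}\subset\mathscr{B}$, $f^{-1}(S)$ is an $\mathscr{N}$-essential supremum of $\{f^{-1}(F):F\in\mathscr{F}\}$. A saturated MSN is cccc if it is a coproduct in $\mathsf{MSN_{sp}}$ of a family of ccc saturated MSNs. A cccc version (resp. lld version) of an object $X$ of $\mathsf{MSN_{sp}}$ is a pair $(\hat X,\mathbf{p})$, where $\hat X$ is cccc (resp. lld) and $\mathbf{p}:\hat X\to X$ is a morphism of $\mathsf{MSN_{sp}}$, such that for every cccc (resp. lld) $Y$ and every morphism $\mathbf{q}:Y\to X$ of $\mathsf{MSN_{sp}}$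 there is a unique morphism $\mathbf{r}:Y\to\hat X$ of $\mathsf{MSN_{sp}}$ with $\mathbf{q}=\mathbf{p}\circ\mathbf{r}$. **Theorem.** Let $(X,\mathscr{A},\mathscr{N})$ be a saturated MSN, and let $\mathscr{E}_{\mathrm{ccc}}$ be the family of all $Z\in\mathscr{A}$ such that $(Z,\mathscr{A}_Z,\mathscr{N}_Z)$ is ccc, where $\mathscr{A}_Z=\{A\in\mathscr{A}:A\subset Z\}$ and $\mathscr{N}_Z=\{N\in\mathscr{N}:N\subset Z\}$. Assume that $(X,\mathscr{A},\mathscr{N})$ is locally ccc, i.e. that $\mathscr{E}_{\mathrm{ccc}}$ is $\mathscr{N}$-generating. Then: 1. $(X,\mathscr{A},\mathscr{N})$ admits a cccc version. 2. If furthermore $\mathscr{E}_{\mathrm{ccc}}$ contains an $\mathscr{N}$-generating subfamily $\mathscr{E}$ of cardinality at most $\mathfrak{c}=2^{\aleph_0}$ such that, for each $Z\in\mathscr{E}$, $(Z,\mathscr{A}_Z)$ is countably separated (i.e. some countable subfamily of $\mathscr{A}_Z$ separates the points of $Z$), then $(X,\mathscr{A},\mathscr{N})$ admits an lld version which is also its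 cccc version. -/

import Mathlib

open CategoryTheory

universe u

/-- A saturated measurable space with negligibles `(X, 𝒜, 𝒩)`: a set with a σ-algebra `𝒜` and a
σ-ideal `𝒩 ⊆ 𝒜` such that every subset of a member of `𝒩` belongs to `𝒩`. -/
structure SatMSN : Type (u + 1) where
  /-- The underlying set. -/
  carrier : Type u
  /-- The σ-algebra. -/
  meas : MeasurableSpace carrier
  /-- The σ-ideal of negligible sets. -/
  negl : Set (Set carrier)
  measurableSet_of_negl : ∀ N ∈ negl, MeasurableSet N
  empty_negl : ∅ ∈ negl
  iUnion_negl : ∀ N : ℕ → Set carrier, (∀ n, N n ∈ negl) → (⋃ n, N n) ∈ negl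
  saturated : ∀ N N' : Set carrier, N ⊆ N' → N' ∈ negl → N ∈ negl

namespace SatMSN

instance : CoeSort SatMSN.{u} (Type u) := ⟨carrier⟩

instance (X : SatMSN.{u}) : MeasurableSpace X := X.meas

theorem union_negl (X : SatMSN.{u}) {N M : Set X} (hN : N ∈ X.negl) (hM : M ∈ X.negl) :
    N ∪ M ∈ X.negl := by
  have h := X.iUnion_negl (fun n => if n = 0 then N else M)
    (fun n => by by_cases hn : n = 0 <;> simp [hn, hN, hM])
  refine X.saturated _ _ ?_ h
  rintro x (hx | hx)
  · exact Set.mem_iUnion.2 ⟨0, by simpa using hx⟩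
  · exact Set.mem_iUnion.2 ⟨1, by simpa using hx⟩

/-- `S ∈ 𝒜` is an `𝒩`-essential supremum of the family `F`. -/
def IsEssSup (X : SatMSN.{u}) (F : Set (Set X)) (S : Set X) : Prop :=
  MeasurableSet S ∧ (∀ E ∈ F, E \ S ∈ X.negl) ∧
    ∀ B : Set X, MeasurableSet B → (∀ E ∈ F, E \ B ∈ X.negl) → S \ B ∈ X.negl

/-- `E ⊆ 𝒜` is `𝒩`-generating: the whole space is an `𝒩`-essential supremum of `E`. -/
def IsGenerating (X : SatMSN.{u}) (E : Set (Set X)) : Prop :=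
  (∀ Z ∈ E, MeasurableSet Z) ∧ X.IsEssSup E Set.univ

/-- Localizable: every subfamily of `𝒜` has an `𝒩`-essential supremum. -/
def IsLocalizable (X : SatMSN.{u}) : Prop :=
  ∀ F : Set (Set X), (∀ E ∈ F, MeasurableSet E) → ∃ S, X.IsEssSup F S

/-- Locally determined: measurability can be tested on the members of any `𝒩`-generating family. -/
def IsLocallyDetermined (X : SatMSN.{u}) : Prop :=
  ∀ E : Set (Set X), X.IsGenerating E →
    ∀ A : Set X, (∀ Z ∈ E, MeasurableSet (A ∩ Z)) → MeasurableSet A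

/-- lld: localizable and locally determined. -/
def IsLLD (X : SatMSN.{u}) : Prop := X.IsLocalizable ∧ X.IsLocallyDetermined

/-- The countable chain condition: every almost disjointed family of measurable non-negligible
sets is countable. -/
def IsCCC (X : SatMSN.{u}) : Prop :=
  ∀ F : Set (Set X), (∀ E ∈ F, MeasurableSet E ∧ E ∉ X.negl) →
    F.Pairwise (fun E E' => E ∩ E' ∈ X.negl) → F.Countable

/-- The sub-MSN `(Z, 𝒜_Z, 𝒩_Z)` on a subset `Z`, with the trace σ-algebra and the negligible sets
contained in `Z`. -/
def sub (X : SatMSN.{u}) (Z : Set X) : SatMSN.{u} where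
  carrier := Z
  meas := MeasurableSpace.comap Subtype.val X.meas
  negl := {N | Subtype.val '' N ∈ X.negl}
  measurableSet_of_negl N hN :=
    ⟨Subtype.val '' N, X.measurableSet_of_negl _ hN,
      Set.preimage_image_eq N Subtype.val_injective⟩
  empty_negl := by simpa using X.empty_negl
  iUnion_negl N hN := by
    simp only [Set.mem_ofPred_eq, Set.image_iUnion] at hN ⊢
    exact X.iUnion_negl _ hN
  saturated _ _ h h' := X.saturated _ _ (Set.image_mono h) h'

/-- The family `ℰ_ccc` of all measurable sets whose sub-MSN is ccc. -/
def cccSets (X : SatMSN.{u}) : Set (Set X) := {Z | MeasurableSet Z ∧ (X.sub Z).IsCCC}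

/-- Locally ccc: `ℰ_ccc` is `𝒩`-generating. -/
def IsLocallyCCC (X : SatMSN.{u}) : Prop := X.IsGenerating X.cccSets

/-- The supremum preserving `[(𝒜, 𝒩), (ℬ, ℳ)]`-measurable maps from `X` to `Y`. -/
structure SPMap (X Y : SatMSN.{u}) : Type u where
  /-- The underlying function. -/
  toFun : X → Y
  measurableSet_preimage : ∀ B : Set Y, MeasurableSet B → MeasurableSet (toFun ⁻¹' B)
  negl_preimage : ∀ M ∈ Y.negl, toFun ⁻¹' M ∈ X.negl
  sup_preserving : ∀ F : Set (Set Y), (∀ E ∈ F, MeasurableSet E) → ∀ S : Set Y,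
    Y.IsEssSup F S → X.IsEssSup ((fun E => toFun ⁻¹' E) '' F) (toFun ⁻¹' S)

/-- Equality of maps outside a negligible set. -/
instance SPMap.setoid (X Y : SatMSN.{u}) : Setoid (SPMap X Y) where
  r f g := {x | f.toFun x ≠ g.toFun x} ∈ X.negl
  iseqv :=
    { refl := fun f => by simpa using X.empty_negl
      symm := fun {f g} h => by simpa only [ne_comm] using h
      trans := fun {f g k} h h' => by
        refine X.saturated _ _ ?_ (X.union_negl h h')
        intro x hx
        by_contra hc
        simp only [Set.mem_union, Set.mem_ofPred_eq, not_or, not_not] at hc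
        exact hx (hc.1.trans hc.2) }

/-- The identity map. -/
def SPMap.id (X : SatMSN.{u}) : SPMap X X where
  toFun x := x
  measurableSet_preimage _ h := h
  negl_preimage _ h := h
  sup_preserving F _ S h := by simpa using h

/-- The composition `g ∘ f`. -/
def SPMap.comp {X Y Z : SatMSN.{u}} (f : SPMap X Y) (g : SPMap Y Z) : SPMap X Z where
  toFun x := g.toFun (f.toFun x)
  measurableSet_preimage B h := f.measurableSet_preimage _ (g.measurableSet_preimage B h)
  negl_preimage M h := f.negl_preimage _ (g.negl_preimage M h)
  sup_preserving F hF S h := by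
    have h1 := f.sup_preserving _
      (by rintro _ ⟨E, hE, rfl⟩; exact g.measurableSet_preimage E (hF E hE)) _
      (g.sup_preserving F hF S h)
    rwa [Set.image_image] at h1

/-- The category `MSN_sp`: objects are the saturated MSNs, morphisms are the classes modulo
almost everywhere equality of supremum preserving measurable maps. -/
instance : Category.{u} SatMSN.{u} where
  Hom X Y := Quotient (SPMap.setoid X Y)
  id X := Quotient.mk _ (SPMap.id X)
  comp {X Y Z} := Quotient.map₂ SPMap.comp (by
    intro f f' hf g g' hg
    refine X.saturated _ _ ?_ (X.union_negl hf (f'.negl_preimage _ hg))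
    intro x hx
    by_contra hc
    simp only [Set.mem_union, Set.mem_ofPred_eq, Set.mem_preimage, not_or, not_not] at hc
    refine hx ?_
    change g.toFun (f.toFun x) = g'.toFun (f'.toFun x)
    rw [hc.1, hc.2])
  id_comp f := by induction f using Quotient.inductionOn; rfl
  comp_id f := by induction f using Quotient.inductionOn; rfl
  assoc f g h := by
    induction f using Quotient.inductionOn
    induction g using Quotient.inductionOn
    induction h using Quotient.inductionOn
    rfl

/-- cccc: a coproduct, in the category `MSN_sp`, of a family of ccc saturated MSNs. -/
def IsCCCC (X : SatMSN.{u}) : Prop :=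
  ∃ (ι : Type u) (W : ι → SatMSN.{u}) (inj : ∀ i, W i ⟶ X),
    (∀ i, (W i).IsCCC) ∧ Nonempty (Limits.IsColimit (Limits.Cofan.mk X inj))

/-- `(Xh, p)` is a coreflection of `X` along the inclusion into `MSN_sp` of the full subcategory
of the objects satisfying `P`. -/
def IsCoreflection (P : SatMSN.{u} → Prop) {X Xh : SatMSN.{u}} (p : Xh ⟶ X) : Prop :=
  P Xh ∧ ∀ (Y : SatMSN.{u}), P Y → ∀ q : Y ⟶ X, ∃! r : Y ⟶ Xh, r ≫ p = q

/-- `(Xh, p)` is a cccc version of `X`. -/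
def IsCCCCVersion {X Xh : SatMSN.{u}} (p : Xh ⟶ X) : Prop := IsCoreflection IsCCCC p

/-- `(Xh, p)` is an lld version of `X`. -/
def IsLLDVersion {X Xh : SatMSN.{u}} (p : Xh ⟶ X) : Prop := IsCoreflection IsLLD p

end SatMSN

namespace SatMSN

/-! By Zorn, a locally ccc space has a generating family `K` of pairwise almost disjoint ccc sets
(`IsLocallyCCC.exists_family`). The version is the disjoint union of the pieces `k ∈ K`. Lifting `q
: Y → X` amounts to choosing, for almost every `y`, a `k` containing `q y`: the choice may fail only
on a negligible set over each `k` (`lift`). Almost disjointness makes the lift unique when `Y` is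
locally determined (`pieces_unique`).

If `Y` is ccc, only countably many `k` have non-negligible preimage, so an arbitrary choice among
these works. A cccc space is handled summand by summand. If `Y` is localizable and `K` has at most
continuum many members, they are coded by subsets of `ℕ`, and countably many essential suprema in
`Y` recover the code (`IsLocalizable.exists_choice`). The cardinality bound holds because each
non-negligible `k` meets some `Z ∈ E` non-negligibly, while each ccc `Z` allows only countably many
such `k`. -/

theorem negl_mono (X : SatMSN.{u}) {N N' : Set X} (h : N' ∈ X.negl) (hN : N ⊆ N') : N ∈ X.negl :=
  X.saturated N N' hN h

theorem measurableSet_of_diff_negl (X : SatMSN.{u}) {A B : Set X} (hA : MeasurableSet A)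
    (h : A \ B ∈ X.negl) (h' : B \ A ∈ X.negl) : MeasurableSet B := by
  have : B = (A \ (A \ B)) ∪ (B \ A) := by
    ext x; simp only [Set.mem_union, Set.mem_sdiff]; tauto
  rw [this]
  exact (hA.diff (X.measurableSet_of_negl _ h)).union (X.measurableSet_of_negl _ h')

theorem biUnion_negl (X : SatMSN.{u}) {ι : Type*} {J : Set ι} (hJ : J.Countable)
    {N : ι → Set X} (h : ∀ j ∈ J, N j ∈ X.negl) : (⋃ j ∈ J, N j) ∈ X.negl := by
  rcases J.eq_empty_or_nonempty with rfl | hne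
  · simpa using X.empty_negl
  · obtain ⟨f, rfl⟩ := hJ.exists_eq_range hne
    rw [Set.biUnion_range]
    exact X.iUnion_negl _ fun n => h _ ⟨n, rfl⟩

theorem iUnion_subset_negl (X : SatMSN.{u}) {A : Set X} {N : ℕ → Set X}
    (h : ∀ n, N n ∈ X.negl) (hA : A ⊆ ⋃ n, N n) : A ∈ X.negl :=
  X.saturated _ _ hA (X.iUnion_negl N h)

/-- A measurable set is negligible as soon as its traces on a generating family are. -/
theorem IsGenerating.negl_of_inter {X : SatMSN.{u}} {E : Set (Set X)} (hE : X.IsGenerating E)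
    {A : Set X} (hA : MeasurableSet A) (h : ∀ Z ∈ E, A ∩ Z ∈ X.negl) : A ∈ X.negl := by
  have := hE.2.2.2 Aᶜ hA.compl fun Z hZ => X.saturated _ (A ∩ Z) (fun x hx => ⟨by
    simpa using hx.2, hx.1⟩) (h Z hZ)
  simpa [← Set.compl_eq_univ_sdiff] using this

theorem isGenerating_of_inter {X : SatMSN.{u}} {E : Set (Set X)}
    (hm : ∀ Z ∈ E, MeasurableSet Z)
    (h : ∀ A : Set X, MeasurableSet A → (∀ Z ∈ E, A ∩ Z ∈ X.negl) → A ∈ X.negl) :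
    X.IsGenerating E := by
  refine ⟨hm, MeasurableSet.univ, fun Z _ => by simpa using X.empty_negl, fun B hB hEB => ?_⟩
  rw [← Set.compl_eq_univ_sdiff]
  exact h _ hB.compl fun Z hZ => X.saturated _ (Z \ B) (fun x hx => ⟨hx.2, hx.1⟩) (hEB Z hZ)

/-- Generating families pull back to generating families. -/
theorem SPMap.isGenerating_preimage {X Y : SatMSN.{u}} (f : SPMap X Y) {E : Set (Set Y)}
    (hE : Y.IsGenerating E) : X.IsGenerating ((fun Z => f.toFun ⁻¹' Z) '' E) := by
  refine ⟨?_, by simpa using f.sup_preserving E hE.1 _ hE.2⟩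
  rintro _ ⟨Z, hZ, rfl⟩
  exact f.measurableSet_preimage Z (hE.1 Z hZ)

/-! ### Almost disjoint families and the countable chain condition -/

/-- A maximal almost disjointed subfamily of a family of non-negligible sets. -/
theorem exists_maximal_almostDisjoint (X : SatMSN.{u}) (G : Set (Set X))
    (hG : ∀ Z ∈ G, Z ∉ X.negl) :
    ∃ M ⊆ G, M.Pairwise (fun E E' => E ∩ E' ∈ X.negl) ∧
      ∀ Z ∈ G, ∃ E ∈ M, E ∩ Z ∉ X.negl := by
  obtain ⟨M, hM⟩ := zorn_subset
    {M : Set (Set X) | M ⊆ G ∧ M.Pairwise (fun E E' => E ∩ E' ∈ X.negl)} (by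
      intro c hc hchain
      refine ⟨⋃₀ c, ⟨Set.sUnion_subset fun s hs => (hc hs).1, ?_⟩,
        fun s hs => Set.subset_sUnion_of_mem hs⟩
      exact (Set.pairwise_sUnion hchain.directedOn).2 fun s hs => (hc hs).2)
  refine ⟨M, hM.prop.1, hM.prop.2, fun Z hZ => ?_⟩
  by_contra! hcon
  have hmem : insert Z M ∈
      {M : Set (Set X) | M ⊆ G ∧ M.Pairwise (fun E E' => E ∩ E' ∈ X.negl)} := by
    refine ⟨Set.insert_subset hZ hM.prop.1, hM.prop.2.insert fun E hE _ => ?_⟩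
    exact ⟨Set.inter_comm E Z ▸ hcon E hE, hcon E hE⟩
  have hZM : Z ∈ M := hM.le_of_ge hmem (Set.subset_insert _ _) (Set.mem_insert _ _)
  exact hG Z hZ (by simpa using hcon Z hZM)

/-- In a ccc space, every family has a countable subfamily whose union is an essential
supremum. -/
theorem IsCCC.exists_countable_isEssSup {X : SatMSN.{u}} (hX : X.IsCCC) (F : Set (Set X))
    (hF : ∀ E ∈ F, MeasurableSet E) :
    ∃ F' ⊆ F, F'.Countable ∧ X.IsEssSup F (⋃₀ F') := by
  -- Members of `F` may overlap, so maximality is taken among their non-negligible measurable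
  -- subsets; each such subset is then enlarged to a member of `F`. A non-negligible remainder of
  -- some `E` would be disjoint from all of `M`.
  obtain ⟨M, hMG, hMd, hMm⟩ := X.exists_maximal_almostDisjoint
    {H | MeasurableSet H ∧ H ∉ X.negl ∧ ∃ E ∈ F, H ⊆ E} fun Z hZ => hZ.2.1
  have hMc : M.Countable := hX M (fun E hE => ⟨(hMG hE).1, (hMG hE).2.1⟩) hMd
  choose! g hgF hg using fun H (hH : H ∈ M) => (hMG hH).2.2
  have hsub : g '' M ⊆ F := by rintro _ ⟨H, hH, rfl⟩; exact hgF H hH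
  have hcount := hMc.image g
  have hmeas : MeasurableSet (⋃₀ (g '' M)) :=
    MeasurableSet.sUnion hcount fun E hE => hF E (hsub hE)
  refine ⟨g '' M, hsub, hcount, hmeas, fun E hE => ?_, fun B _ hFB => ?_⟩
  · by_contra hcon
    obtain ⟨H, hH, hHE⟩ := hMm (E \ ⋃₀ (g '' M))
      ⟨(hF E hE).diff hmeas, hcon, E, hE, Set.sdiff_subset⟩
    refine hHE (X.saturated _ _ ?_ X.empty_negl)
    exact fun x hx => hx.2.2 ⟨g H, ⟨H, hH, rfl⟩, hg H hH hx.1⟩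
  · refine X.saturated _ _ ?_ (X.biUnion_negl hcount (N := fun E => E \ B)
      fun E hE => hFB E (hsub hE))
    rintro x ⟨⟨E, hE, hx⟩, hxB⟩
    exact Set.mem_biUnion hE ⟨hx, hxB⟩

theorem IsCCC.exists_countable_of_isGenerating {X : SatMSN.{u}} (hX : X.IsCCC)
    {E : Set (Set X)} (hE : X.IsGenerating E) :
    ∃ F ⊆ E, F.Countable ∧ (⋃₀ F)ᶜ ∈ X.negl := by
  obtain ⟨F, hFE, hFc, hF⟩ := hX.exists_countable_isEssSup E hE.1
  refine ⟨F, hFE, hFc, ?_⟩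
  rw [Set.compl_eq_univ_sdiff]
  exact hE.2.2.2 _ hF.1 hF.2.1

/-- Countable subfamilies suffice for both properties: their unions are essential suprema, and for a
generating family the uncovered part is negligible, hence measurable by saturation. -/
theorem IsCCC.isLLD {X : SatMSN.{u}} (hX : X.IsCCC) : X.IsLLD := by
  refine ⟨fun F hF => ?_, fun E hE A hA => ?_⟩
  · obtain ⟨F', -, -, h⟩ := hX.exists_countable_isEssSup F hF
    exact ⟨_, h⟩
  · obtain ⟨F, hFE, hFc, hF⟩ := hX.exists_countable_of_isGenerating hE
    have : A = (⋃ Z ∈ F, A ∩ Z) ∪ (A ∩ (⋃₀ F)ᶜ) := by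
      rw [← Set.inter_iUnion₂, ← Set.sUnion_eq_biUnion, Set.inter_union_compl]
    rw [this]
    exact (MeasurableSet.biUnion hFc fun Z hZ => hA Z (hFE hZ)).union
      (X.measurableSet_of_negl _ (X.saturated _ _ Set.inter_subset_right hF))

/-! ### Coproducts -/

/-- The disjoint union of a family of saturated MSNs. -/
def sigma {ι : Type u} (W : ι → SatMSN.{u}) : SatMSN.{u} where
  carrier := Σ i, W i
  meas :=
    { MeasurableSet' := fun A => ∀ i, MeasurableSet (Sigma.mk i ⁻¹' A)
      measurableSet_empty := fun i => by simp
      measurableSet_compl := fun A hA i => (hA i).compl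
      measurableSet_iUnion := fun A hA i => by
        rw [Set.preimage_iUnion]
        exact MeasurableSet.iUnion fun n => hA n i }
  negl := {N | ∀ i, Sigma.mk i ⁻¹' N ∈ (W i).negl}
  measurableSet_of_negl N hN i := (W i).measurableSet_of_negl _ (hN i)
  empty_negl i := (W i).empty_negl
  iUnion_negl N hN i := by
    rw [Set.preimage_iUnion]
    exact (W i).iUnion_negl _ fun n => hN n i
  saturated N N' h hN' i := (W i).saturated _ _ (Set.preimage_mono h) (hN' i)

section sigma

variable {ι : Type u} (W : ι → SatMSN.{u})

/-- The inclusion of a summand, as a function. -/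
abbrev sigmaMk (i : ι) (x : W i) : sigma W := ⟨i, x⟩

/-- Extension of a subset of one summand by the other summands. -/
theorem exists_sigma_extension (i : ι) {B : Set (W i)} (hB : MeasurableSet B) :
    ∃ C : Set (sigma W), MeasurableSet C ∧ sigmaMk W i ⁻¹' C = B ∧
      ∀ j ≠ i, sigmaMk W j ⁻¹' C = Set.univ := by
  have h1 : sigmaMk W i ⁻¹' (sigmaMk W i '' Bᶜ)ᶜ = B := by
    have hinj : Function.Injective (sigmaMk W i) := fun _ _ h =>
      eq_of_heq (Sigma.mk.inj h).2
    rw [Set.preimage_compl, Set.preimage_image_eq _ hinj, compl_compl]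
  have h2 : ∀ j ≠ i, sigmaMk W j ⁻¹' (sigmaMk W i '' Bᶜ)ᶜ = Set.univ := by
    intro j hj
    rw [Set.eq_univ_iff_forall]
    rintro x ⟨y, -, hy⟩
    exact hj (congrArg Sigma.fst hy).symm
  refine ⟨(sigmaMk W i '' Bᶜ)ᶜ, fun j => ?_, h1, h2⟩
  change MeasurableSet (sigmaMk W j ⁻¹' _)
  by_cases hj : j = i
  · subst hj
    rwa [h1]
  · rw [h2 j hj]
    exact MeasurableSet.univ

/-- The inclusion of a summand. -/
def sigmaInj (i : ι) : SPMap (W i) (sigma W) where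
  toFun := sigmaMk W i
  measurableSet_preimage _ hB := hB i
  negl_preimage _ hM := hM i
  sup_preserving F _ S hS := by
    refine ⟨hS.1 i, ?_, fun B hB hFB => ?_⟩
    · rintro _ ⟨E, hE, rfl⟩
      exact hS.2.1 E hE i
    -- Filling up the other summands makes `E \ C` empty there, so only summand `i` is tested.
    · obtain ⟨C, hC, hCi, hCj⟩ := exists_sigma_extension W i hB
      have h := hS.2.2 C hC (fun E hE j => ?_) i
      · rw [← hCi]
        exact h
      · change sigmaMk W j ⁻¹' (E \ C) ∈ (W j).negl
        rw [Set.preimage_sdiff]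
        by_cases hj : j = i
        · subst hj
          rw [hCi]
          exact hFB _ ⟨E, hE, rfl⟩
        · rw [hCj j hj, Set.sdiff_univ]
          exact (W j).empty_negl

/-- The map out of a disjoint union defined by its restrictions to the summands. -/
def sigmaDesc {Y : SatMSN.{u}} (f : ∀ i, SPMap (W i) Y) : SPMap (sigma W) Y where
  toFun x := (f x.1).toFun x.2
  measurableSet_preimage B hB i := (f i).measurableSet_preimage B hB
  negl_preimage M hM i := (f i).negl_preimage M hM
  sup_preserving F hF S hS := by
    have h := fun i => (f i).sup_preserving F hF S hS
    refine ⟨fun i => (h i).1, ?_, fun B hB hFB i => (h i).2.2 _ (hB i) ?_⟩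
    · rintro _ ⟨E, hE, rfl⟩ i
      exact (h i).2.1 _ ⟨E, hE, rfl⟩
    · rintro _ ⟨E, hE, rfl⟩
      exact hFB _ ⟨E, hE, rfl⟩ i

/-- The inclusion of a summand, as a morphism. -/
def sigmaι (i : ι) : W i ⟶ sigma W := Quotient.mk _ (sigmaInj W i)

/-- The disjoint union is a coproduct in `MSN_sp`. -/
noncomputable def sigmaIsColimit : Limits.IsColimit (Limits.Cofan.mk (sigma W) (sigmaι W)) :=
  Limits.Cofan.IsColimit.mk _
    (fun s => Quotient.mk _ (sigmaDesc W fun i => (s.inj i).out))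
    (fun s i => Quotient.out_eq (s.inj i))
    (fun s m hm => by
      induction m using Quotient.inductionOn with
      | h m =>
        refine Quotient.sound fun i => ?_
        have h : Quotient.mk (SPMap.setoid _ _) ((sigmaInj W i).comp m) = s.inj i := hm i
        rw [← Quotient.out_eq (s.inj i)] at h
        exact Quotient.exact (s := SPMap.setoid _ _) h)

theorem isCCCC_sigma (hW : ∀ i, (W i).IsCCC) : (sigma W).IsCCCC :=
  ⟨ι, W, sigmaι W, hW, ⟨sigmaIsColimit W⟩⟩

theorem isLLD_sigma (hW : ∀ i, (W i).IsLLD) : (sigma W).IsLLD := by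
  refine ⟨fun F hF => ?_, fun E hE A hA i => ?_⟩
  · have h : ∀ i, ∃ S, (W i).IsEssSup ((fun E => sigmaMk W i ⁻¹' E) '' F) S := fun i =>
      (hW i).1 _ (by rintro _ ⟨E, hE, rfl⟩; exact hF E hE i)
    choose S hS using h
    refine ⟨{x | x.2 ∈ S x.1}, fun i => (hS i).1, fun E hE i => (hS i).2.1 _ ⟨E, hE, rfl⟩,
      fun B hB hFB i => (hS i).2.2 _ (hB i) ?_⟩
    rintro _ ⟨E, hE, rfl⟩
    exact hFB E hE i
  · refine (hW i).2 _ ((sigmaInj W i).isGenerating_preimage hE) _ ?_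
    rintro _ ⟨Z, hZ, rfl⟩
    exact hA Z hZ i

/-- The summands of a disjoint union form a generating family. -/
theorem isGenerating_sigma :
    (sigma W).IsGenerating (Set.range fun i => {x : sigma W | x.1 = i}) := by
  refine isGenerating_of_inter ?_ fun A _ h i => ?_
  · rintro _ ⟨i, rfl⟩ j
    exact MeasurableSet.const (j = i)
  · refine (W i).saturated _ _ ?_ (h _ ⟨i, rfl⟩ i)
    exact fun x hx => ⟨hx, rfl⟩

end sigma

/-! ### Restrictions -/

/-- The space `X` in which the complement of a measurable set `Z` has been made negligible. -/
def restrict (X : SatMSN.{u}) (Z : Set X) (hZ : MeasurableSet Z) : SatMSN.{u} where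
  -- Keeping all points of `X` lets a lift retain the value `q y` even where the chosen piece does
  -- not contain it.
  carrier := X
  meas :=
    { MeasurableSet' := fun A : Set X => MeasurableSet (A ∩ Z)
      measurableSet_empty := by simp
      measurableSet_compl := fun A hA => by
        have : Aᶜ ∩ Z = Z \ (A ∩ Z) := by ext; simp; tauto
        rw [this]
        exact hZ.diff hA
      measurableSet_iUnion := fun A hA => by
        rw [Set.iUnion_inter]
        exact MeasurableSet.iUnion hA }
  negl := {N : Set X | N ∩ Z ∈ X.negl}
  measurableSet_of_negl N hN := X.measurableSet_of_negl _ hN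
  empty_negl := by simpa using X.empty_negl
  iUnion_negl N hN := by
    simp only [Set.mem_ofPred_eq, Set.iUnion_inter] at hN ⊢
    exact X.iUnion_negl _ hN
  saturated N N' h h' := X.saturated (N ∩ Z) (N' ∩ Z) (Set.inter_subset_inter_left Z h) h'

section restrict

variable {X : SatMSN.{u}}

/-- Traces on `Z` transfer the family to the subspace. Distinct members keep distinct traces:
otherwise their negligible intersection would contain a non-negligible trace. -/
theorem isCCC_restrict_inter {Z B : Set X} (hZ : Z ∈ X.cccSets) (hB : MeasurableSet B) :
    (X.restrict (Z ∩ B) (hZ.1.inter hB)).IsCCC := by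
  intro F hF hFd
  change Set (Set X) at F
  have hFn : ∀ E ∈ F, E ∩ (Z ∩ B) ∉ X.negl := fun E hE => (hF E hE).2
  have hFm : ∀ E ∈ F, MeasurableSet (E ∩ (Z ∩ B)) := fun E hE => (hF E hE).1
  have hFd' : ∀ E ∈ F, ∀ E' ∈ F, E ≠ E' → (E ∩ E') ∩ (Z ∩ B) ∈ X.negl :=
    fun E hE E' hE' h => hFd hE hE' h
  let g : Set X → Set (X.sub Z) := fun E => Subtype.val ⁻¹' (E ∩ B)
  have himg : ∀ E : Set X, Subtype.val '' g E = E ∩ (Z ∩ B) := fun E => by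
    ext x
    simp only [g, sub, Set.mem_image, Set.mem_preimage, Set.mem_inter_iff, Subtype.exists,
      exists_and_right, exists_eq_right]
    tauto
  have hinj : Set.InjOn g F := by
    intro E hE E' hE' h
    by_contra hne
    refine hFn E hE (X.saturated _ _ ?_ (hFd' E hE E' hE' hne))
    have h' : E ∩ (Z ∩ B) = E' ∩ (Z ∩ B) := by rw [← himg, ← himg, h]
    exact fun x hx => ⟨⟨hx.1, (h' ▸ hx : x ∈ E' ∩ (Z ∩ B)).1⟩, hx.2⟩
  refine Set.countable_of_injective_of_countable_image hinj (hZ.2 (g '' F) ?_ ?_)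
  · rintro _ ⟨E, hE, rfl⟩
    refine ⟨⟨E ∩ (Z ∩ B), hFm E hE, ?_⟩, fun h => hFn E hE ?_⟩
    · ext x
      exact ⟨fun h => ⟨h.1, h.2.2⟩, fun h => ⟨h.1, x.2, h.2⟩⟩
    · rw [← himg]
      exact h
  · rintro _ ⟨E, hE, rfl⟩ _ ⟨E', hE', rfl⟩ hne
    refine X.negl_mono (hFd' E hE E' hE' fun h => hne (h ▸ rfl)) ?_
    rintro _ ⟨x, hx, rfl⟩
    exact ⟨⟨hx.1.1, hx.2.1⟩, x.2, hx.1.2⟩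

theorem isCCC_restrict_of_mem {Z : Set X} (hZ : Z ∈ X.cccSets) :
    (X.restrict Z hZ.1).IsCCC := by
  have h := isCCC_restrict_inter hZ MeasurableSet.univ
  simpa only [Set.inter_univ] using h

theorem isCCC_restrict_empty : (X.restrict ∅ MeasurableSet.empty).IsCCC := by
  intro F hF _
  have : F = ∅ := Set.eq_empty_of_forall_notMem fun E hE => (hF E hE).2
    (X.negl_mono X.empty_negl fun _ hx => hx.2)
  rw [this]
  exact Set.countable_empty

/-- The identity map from a restriction. -/
def restrictMap (X : SatMSN.{u}) (Z : Set X) (hZ : MeasurableSet Z) :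
    SPMap (X.restrict Z hZ) X where
  toFun x := x
  measurableSet_preimage _ hB := hB.inter hZ
  negl_preimage _ hM := X.saturated _ _ Set.inter_subset_left hM
  sup_preserving F _ S hS := by
    refine ⟨hS.1.inter hZ, ?_, fun B hB hFB => ?_⟩
    · rintro _ ⟨E, hE, rfl⟩
      exact X.saturated _ _ Set.inter_subset_left (hS.2.1 E hE)
    · change Set X at B
      have hB' : MeasurableSet (B ∩ Z) := hB
      -- Only `B ∩ Z` is known to be measurable in `X`; adding `Zᶜ` discards whatever lies outside
      -- `Z`.
      have h := hS.2.2 (B ∩ Z ∪ Zᶜ) (hB'.union hZ.compl) fun E hE => by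
        refine X.saturated _ _ ?_ (hFB _ ⟨E, hE, rfl⟩)
        intro x hx
        simp only [Set.mem_sdiff, Set.mem_union, Set.mem_inter_iff, Set.mem_compl_iff] at hx
        exact ⟨⟨hx.1, by tauto⟩, by tauto⟩
      refine X.saturated _ _ ?_ h
      rintro x ⟨⟨hxS, hxB⟩, hxZ⟩
      exact ⟨hxS, fun hx => hx.elim (fun h => hxB h.1) fun h => h hxZ⟩

end restrict

/-! ### The disjoint union of the members of an almost disjointed generating family -/

section pieces

variable {X : SatMSN.{u}} {K : Set (Set X)}

/-- The disjoint union of the restrictions of `X` to the members of `K`. -/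
def pieces (X : SatMSN.{u}) (K : Set (Set X)) (hK : ∀ k ∈ K, MeasurableSet k) : SatMSN.{u} :=
  sigma fun k : K => X.restrict k (hK k k.2)

/-- The projection of the disjoint union of the members of `K`. -/
def piecesMap (X : SatMSN.{u}) (K : Set (Set X)) (hK : ∀ k ∈ K, MeasurableSet k) :
    SPMap (X.pieces K hK) X :=
  sigmaDesc _ fun k : K => X.restrictMap k (hK k k.2)

/-- A map `q` to `X`, together with an almost everywhere correct choice of a member of `K`
containing `q y`, lifts to the disjoint union of the members of `K`. -/
def lift (hK : X.IsGenerating K) {Y : SatMSN.{u}} (hY : Y.IsLocallyDetermined) (q : SPMap Y X)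
    (σ : Y → K) (hσ : ∀ k : K, {y | q.toFun y ∈ (k : Set X) ∧ σ y ≠ k} ∈ Y.negl) :
    SPMap Y (X.pieces K hK.1) :=
  let r : Y → X.pieces K hK.1 := fun y => ⟨σ y, q.toFun y⟩
  let c : K → X → X.pieces K hK.1 := fun k x => ⟨k, x⟩
  have hr : ∀ (B : Set (X.pieces K hK.1)) (k : K) (y : Y), σ y = k →
      (y ∈ r ⁻¹' B ↔ q.toFun y ∈ c k ⁻¹' B) := by
    rintro B k y rfl
    rfl
  have hq := q.isGenerating_preimage hK
  -- Over each `k`, `r ⁻¹' B` agrees with the preimage under `q` of the `k`-th slice of `B`, up to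
  -- the negligible set where `σ` errs. Every property of `r` is thus checked on the generating
  -- family of the `q ⁻¹' k`.
  have hle : ∀ (B : Set (X.pieces K hK.1)) (k : K), r ⁻¹' B ∩ q.toFun ⁻¹' k ⊆
      q.toFun ⁻¹' (c k ⁻¹' B ∩ k) ∪ {y | q.toFun y ∈ (k : Set X) ∧ σ y ≠ k} := by
    rintro B k y ⟨hy, hyk⟩
    by_cases h : σ y = k
    · exact Or.inl ⟨(hr B k y h).1 hy, hyk⟩
    · exact Or.inr ⟨hyk, h⟩
  have hge : ∀ (B : Set (X.pieces K hK.1)) (k : K), q.toFun ⁻¹' (c k ⁻¹' B ∩ k) ⊆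
      r ⁻¹' B ∩ q.toFun ⁻¹' k ∪ {y | q.toFun y ∈ (k : Set X) ∧ σ y ≠ k} := by
    rintro B k y ⟨hy, hyk⟩
    by_cases h : σ y = k
    · exact Or.inl ⟨(hr B k y h).2 hy, hyk⟩
    · exact Or.inr ⟨hyk, h⟩
  have hmeas : ∀ B : Set (X.pieces K hK.1), MeasurableSet B → MeasurableSet (r ⁻¹' B) := by
    intro B hB
    refine hY _ hq _ ?_
    rintro _ ⟨k, hk, rfl⟩
    refine Y.measurableSet_of_diff_negl (q.measurableSet_preimage _ (hB ⟨k, hk⟩))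
      (Y.saturated _ _ ?_ (hσ ⟨k, hk⟩)) (Y.saturated _ _ ?_ (hσ ⟨k, hk⟩))
    · rintro y ⟨hy, hy'⟩
      exact (hge B ⟨k, hk⟩ hy).resolve_left hy'
    · rintro y ⟨hy, hy'⟩
      exact (hle B ⟨k, hk⟩ hy).resolve_left hy'
  { toFun := r
    measurableSet_preimage := hmeas
    negl_preimage := by
      intro M hM
      refine hq.negl_of_inter (hmeas M ((X.pieces K hK.1).measurableSet_of_negl M hM)) ?_
      rintro _ ⟨k, hk, rfl⟩
      exact Y.saturated _ _ (hle M ⟨k, hk⟩)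
        (Y.union_negl (q.negl_preimage _ (hM ⟨k, hk⟩)) (hσ ⟨k, hk⟩))
    sup_preserving := by
      intro F hF S hS
      refine ⟨hmeas S hS.1, ?_, fun B hB hFB => ?_⟩
      · rintro _ ⟨E, hE, rfl⟩
        rw [← Set.preimage_sdiff]
        have hES := hS.2.1 E hE
        refine hq.negl_of_inter (hmeas _ ((X.pieces K hK.1).measurableSet_of_negl _ hES)) ?_
        rintro _ ⟨k, hk, rfl⟩
        exact Y.saturated _ _ (hle _ ⟨k, hk⟩)
          (Y.union_negl (q.negl_preimage _ (hES ⟨k, hk⟩)) (hσ ⟨k, hk⟩))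
      · refine hq.negl_of_inter ((hmeas S hS.1).diff hB) ?_
        rintro _ ⟨k, hk, rfl⟩
        have hSk := (sigmaInj (fun k : K => X.restrict k (hK.1 k k.2)) ⟨k, hk⟩).sup_preserving
          F hF S hS
        -- An essential supremum in the piece becomes one in `X` after cutting by `k`, so that `q`
        -- preserves it.
        have hSk' : X.IsEssSup ((fun E => c ⟨k, hk⟩ ⁻¹' E ∩ k) '' F) (c ⟨k, hk⟩ ⁻¹' S ∩ k) := by
          refine ⟨hSk.1, ?_, fun C hC hFC => ?_⟩
          · rintro _ ⟨E, hE, rfl⟩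
            exact X.negl_mono (hSk.2.1 _ ⟨E, hE, rfl⟩)
              fun x hx => ⟨⟨hx.1.1, fun h => hx.2 ⟨h, hx.1.2⟩⟩, hx.1.2⟩
          · refine X.negl_mono (hSk.2.2 C (hC.inter (hK.1 k hk)) ?_)
              fun x hx => ⟨⟨hx.1.1, hx.2⟩, hx.1.2⟩
            rintro _ ⟨E, hE, rfl⟩
            exact X.negl_mono (hFC _ ⟨E, hE, rfl⟩) fun x hx => ⟨⟨hx.1.1, hx.2⟩, hx.1.2⟩
        have hSq := (q.sup_preserving _ (by
          rintro _ ⟨E, hE, rfl⟩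
          exact hF E hE ⟨k, hk⟩) _ hSk').2.2 B hB (by
            rintro _ ⟨_, ⟨E, hE, rfl⟩, rfl⟩
            refine Y.saturated _ _ ?_ (Y.union_negl (hFB _ ⟨E, hE, rfl⟩) (hσ ⟨k, hk⟩))
            rintro y ⟨hy, hyB⟩
            exact (hge E ⟨k, hk⟩ hy).imp (fun h => ⟨h.1, hyB⟩) id)
        refine Y.saturated _ _ ?_ (Y.union_negl hSq (hσ ⟨k, hk⟩))
        rintro y ⟨⟨hy, hyB⟩, hyk⟩
        exact (hle S ⟨k, hk⟩ ⟨hy, hyk⟩).imp (fun h => ⟨h, hyB⟩) id }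

/-- Lifts to the disjoint union of an almost disjointed family are unique. -/
theorem pieces_unique (hK : ∀ k ∈ K, MeasurableSet k)
    (hKd : K.Pairwise fun E E' => E ∩ E' ∈ X.negl) {Y : SatMSN.{u}}
    (hY : Y.IsLocallyDetermined) (r s : SPMap Y (X.pieces K hK))
    (h : r.comp (X.piecesMap K hK) ≈ s.comp (X.piecesMap K hK)) : r ≈ s := by
  change {y | r.toFun y ≠ s.toFun y} ∈ Y.negl
  have h' : {y | (r.toFun y).2 ≠ (s.toFun y).2} ∈ Y.negl := h
  have hgen := isGenerating_sigma fun k : K => X.restrict k (hK k k.2)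
  have hr := r.isGenerating_preimage hgen
  have hs := s.isGenerating_preimage hgen
  have hout : ∀ (t : SPMap Y (X.pieces K hK)) (k : K),
      {y | (t.toFun y).1 = k ∧ (t.toFun y).2 ∉ (k : Set X)} ∈ Y.negl := by
    intro t k
    refine t.negl_preimage {x | x.1 = k ∧ x.2 ∉ (k : Set X)} fun j => ?_
    refine X.saturated _ ∅ ?_ X.empty_negl
    rintro x ⟨⟨hjk, hx⟩, hxj⟩
    change j = k at hjk
    subst hjk
    exact hx hxj
  -- Almost everywhere the two lifts share their point of `X`, which would then lie in the
  -- negligible set `k ∩ l`.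
  have hdiff : ∀ k l : K, k ≠ l →
      {y | (r.toFun y).1 = k ∧ (s.toFun y).1 = l} ∈ Y.negl := by
    intro k l hkl
    have hkl' : (k : Set X) ∩ l ∈ X.negl := hKd k.2 l.2 fun h => hkl (Subtype.ext h)
    have hN := (r.comp (X.piecesMap K hK)).negl_preimage _ hkl'
    refine Y.saturated _ _ ?_ (Y.union_negl (Y.union_negl (hout r k) (hout s l))
      (Y.union_negl h' hN))
    rintro y ⟨hyk, hyl⟩
    by_contra hcon
    simp only [Set.mem_union, Set.mem_ofPred_eq, not_or, not_and, not_not] at hcon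
    refine hcon.2.2 ⟨hcon.1.1 hyk, ?_⟩
    change (r.toFun y).2 ∈ (l : Set X)
    rw [hcon.2.1]
    exact hcon.1.2 hyl
  have hpiece : ∀ k : K, {y | r.toFun y ≠ s.toFun y} ∩ {y | (r.toFun y).1 = k} ∈ Y.negl := by
    intro k
    have hA : {y | (r.toFun y).1 = k ∧ (s.toFun y).1 ≠ k} ∈ Y.negl := by
      refine hs.negl_of_inter ((hr.1 _ ⟨_, ⟨k, rfl⟩, rfl⟩).inter
        (hs.1 _ ⟨_, ⟨k, rfl⟩, rfl⟩).compl) ?_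
      rintro _ ⟨_, ⟨l, rfl⟩, rfl⟩
      by_cases hkl : k = l
      · subst hkl
        exact Y.saturated _ ∅ (fun y hy => hy.1.2 hy.2) Y.empty_negl
      · exact Y.negl_mono (hdiff k l hkl) fun y hy => ⟨hy.1.1, hy.2⟩
    refine Y.saturated _ _ ?_ (Y.union_negl hA h')
    rintro y ⟨hy, hyk⟩
    by_contra hcon
    simp only [Set.mem_union, Set.mem_ofPred_eq, not_or, not_and, not_not] at hcon
    exact hy (Sigma.ext (hyk.trans (hcon.1 hyk).symm) (heq_of_eq hcon.2))
  -- Generating families detect negligibility only of measurable sets; local determination supplies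
  -- the measurability.
  have hmeas : MeasurableSet {y | r.toFun y ≠ s.toFun y} := by
    refine hY _ hr _ ?_
    rintro _ ⟨_, ⟨k, rfl⟩, rfl⟩
    exact Y.measurableSet_of_negl _ (hpiece k)
  refine hr.negl_of_inter hmeas ?_
  rintro _ ⟨_, ⟨k, rfl⟩, rfl⟩
  exact hpiece k

/-- The projection from the disjoint union of `K`, as a morphism. -/
def piecesHom (X : SatMSN.{u}) (K : Set (Set X)) (hK : ∀ k ∈ K, MeasurableSet k) :
    X.pieces K hK ⟶ X :=
  Quotient.mk _ (X.piecesMap K hK)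

theorem existsUnique_lift (hK : X.IsGenerating K)
    (hKd : K.Pairwise fun E E' => E ∩ E' ∈ X.negl) {Y : SatMSN.{u}}
    (hY : Y.IsLocallyDetermined)
    (hσ : ∀ q : SPMap Y X, ∃ σ : Y → K,
      ∀ k : K, {y | q.toFun y ∈ (k : Set X) ∧ σ y ≠ k} ∈ Y.negl) (q : Y ⟶ X) :
    ∃! r : Y ⟶ X.pieces K hK.1, r ≫ X.piecesHom K hK.1 = q := by
  induction q using Quotient.inductionOn with
  | h q =>
    obtain ⟨σ, hσ⟩ := hσ q
    refine ⟨Quotient.mk _ (lift hK hY q σ hσ), rfl, fun s hs => ?_⟩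
    induction s using Quotient.inductionOn with
    | h s =>
      have hs' : Quotient.mk (SPMap.setoid Y X) (s.comp (X.piecesMap K hK.1)) =
        Quotient.mk _ q := hs
      exact Quotient.sound (pieces_unique hK.1 hKd hY _ _
        (Quotient.exact (s := SPMap.setoid _ _) hs'))

/-! ### Almost everywhere correct choices and the universal properties -/

/-- Over a ccc space, the members of `K` can be chosen among countably many of them. -/
theorem IsCCC.exists_choice (hK : X.IsGenerating K)
    (hKd : K.Pairwise fun E E' => E ∩ E' ∈ X.negl) (hne : K.Nonempty) {Y : SatMSN.{u}}
    (hY : Y.IsCCC) (q : SPMap Y X) :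
    ∃ σ : Y → K, ∀ k : K, {y | q.toFun y ∈ (k : Set X) ∧ σ y ≠ k} ∈ Y.negl := by
  classical
  let J : Set K := {k | q.toFun ⁻¹' k ∉ Y.negl}
  have hqd : ∀ k l : K, k ≠ l → q.toFun ⁻¹' k ∩ q.toFun ⁻¹' l ∈ Y.negl := fun k l hkl =>
    q.negl_preimage _ (hKd k.2 l.2 fun h => hkl (Subtype.ext h))
  have hinj : Set.InjOn (fun k : K => q.toFun ⁻¹' k) J := by
    intro k hk l hl h
    by_contra hkl
    have := hqd k l hkl
    rw [← show q.toFun ⁻¹' k = q.toFun ⁻¹' l from h, Set.inter_self] at this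
    exact hk this
  have hJ : J.Countable := by
    refine Set.countable_of_injective_of_countable_image hinj (hY _ ?_ ?_)
    · rintro _ ⟨k, hk, rfl⟩
      exact ⟨q.measurableSet_preimage _ (hK.1 k k.2), hk⟩
    · rintro _ ⟨k, hk, rfl⟩ _ ⟨l, hl, rfl⟩ h
      exact hqd k l fun hkl => h (hkl ▸ rfl)
  -- The default value is harmless: over `k ∈ J` it is never used, and for `k ∉ J` the whole
  -- preimage is negligible. Over `k ∈ J`, errors lie in countably many negligible overlaps.
  refine ⟨fun y => if h : ∃ k ∈ J, q.toFun y ∈ (k : Set X) then h.choose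
    else ⟨_, hne.some_mem⟩, fun k => ?_⟩
  by_cases hk : k ∈ J
  · refine Y.saturated _ _ ?_ (Y.biUnion_negl (hJ.mono Set.sdiff_subset)
      (J := J \ {k}) (N := fun l => q.toFun ⁻¹' k ∩ q.toFun ⁻¹' l) fun l hl =>
        hqd k l (Ne.symm hl.2))
    rintro y ⟨hyk, hy⟩
    have h : ∃ k ∈ J, q.toFun y ∈ (k : Set X) := ⟨k, hk, hyk⟩
    simp only [dif_pos h] at hy
    exact Set.mem_biUnion (x := h.choose) ⟨h.choose_spec.1, hy⟩ ⟨hyk, h.choose_spec.2⟩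
  · exact Y.saturated _ _ (fun y hy => hy.1) (not_not.1 hk)

/-- Over a localizable space, the members of a family `K` of cardinality at most the continuum can
be chosen by means of a coding of `K` by sets of natural numbers. -/
theorem IsLocalizable.exists_choice (hK : ∀ k ∈ K, MeasurableSet k)
    (hKd : K.Pairwise fun E E' => E ∩ E' ∈ X.negl) (hne : K.Nonempty)
    (hcard : Cardinal.mk K ≤ Cardinal.continuum) {Y : SatMSN.{u}} (hY : Y.IsLocalizable)
    (q : SPMap Y X) :
    ∃ σ : Y → K, ∀ k : K, {y | q.toFun y ∈ (k : Set X) ∧ σ y ≠ k} ∈ Y.negl := by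
  classical
  obtain ⟨⟨code, hcode⟩⟩ : Nonempty (K ↪ Set ℕ) := by
    rw [← Cardinal.lift_mk_le']
    simpa using hcard
  have hqm : ∀ k : K, MeasurableSet (q.toFun ⁻¹' k) := fun k =>
    q.measurableSet_preimage _ (hK k k.2)
  have hD : ∀ n, ∃ D, Y.IsEssSup ((fun k : K => q.toFun ⁻¹' k) '' {k | n ∈ code k}) D :=
    fun n => hY _ (by rintro _ ⟨k, -, rfl⟩; exact hqm k)
  choose D hD using hD
  -- For almost every `y` over `k`, membership in `D n` for all `n` spells out the code of `k`; a
  -- wrong choice forces an error at some digit `n`.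
  refine ⟨fun y => if h : ∃ k, code k = {n | y ∈ D n} then h.choose else ⟨_, hne.some_mem⟩,
    fun k => ?_⟩
  refine Y.iUnion_subset_negl
    (N := fun n => {y | q.toFun y ∈ (k : Set X) ∧ ¬ (n ∈ code k ↔ y ∈ D n)}) (fun n => ?_) ?_
  · by_cases hn : n ∈ code k
    · refine Y.saturated _ _ ?_ ((hD n).2.1 _ ⟨k, hn, rfl⟩)
      exact fun y hy => ⟨hy.1, fun h => hy.2 (iff_of_true hn h)⟩
    -- When `n ∉ code k`, each preimage entering `D n` is almost disjoint from that of `k`, so the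
    -- complement of the latter is an essential upper bound.
    · refine Y.saturated _ _ ?_ ((hD n).2.2 (q.toFun ⁻¹' k)ᶜ (hqm k).compl ?_)
      · exact fun y hy => ⟨by_contra fun h => hy.2 (iff_of_false hn h), fun h => h hy.1⟩
      · rintro _ ⟨l, hl, rfl⟩
        have hlk : l ≠ k := fun h => hn (h ▸ hl)
        refine Y.saturated _ _ ?_ (q.negl_preimage _ (hKd l.2 k.2 fun h => hlk (Subtype.ext h)))
        exact fun y hy => ⟨hy.1, not_not.1 hy.2⟩
  · rintro y ⟨hyk, hy⟩
    by_contra hcon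
    simp only [Set.mem_iUnion, Set.mem_ofPred_eq, not_exists, not_and, not_not] at hcon
    have h : ∃ k, code k = {n | y ∈ D n} := ⟨k, Set.ext fun n => hcon n hyk⟩
    simp only [dif_pos h] at hy
    exact hy (hcode (h.choose_spec.trans (Set.ext fun n => hcon n hyk).symm))

/-- The choice needs countability, available only on each ccc summand of `Y`; the universal property
of the coproduct glues the lifts and their uniqueness. -/
theorem isCCCCVersion_piecesHom (hK : X.IsGenerating K)
    (hKd : K.Pairwise fun E E' => E ∩ E' ∈ X.negl) (hne : K.Nonempty)
    (hccc : ∀ k (hk : k ∈ K), (X.restrict k (hK.1 k hk)).IsCCC) :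
    IsCCCCVersion (X.piecesHom K hK.1) := by
  refine ⟨isCCCC_sigma _ fun k => hccc k k.2, ?_⟩
  rintro Y ⟨ι, W, inj, hW, ⟨hcolim⟩⟩ q
  have h := fun i => existsUnique_lift hK hKd (hW i).isLLD.2
    (fun q => (hW i).exists_choice hK hKd hne q) (inj i ≫ q)
  choose r hr hru using h
  refine ⟨Limits.Cofan.IsColimit.desc hcolim r, ?_, fun s hs => ?_⟩
  · refine Limits.Cofan.IsColimit.hom_ext hcolim _ _ fun i => ?_
    rw [← Category.assoc, Limits.Cofan.IsColimit.fac]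
    exact hr i
  · refine Limits.Cofan.IsColimit.hom_ext hcolim _ _ fun i => ?_
    rw [Limits.Cofan.IsColimit.fac]
    refine hru i _ ?_
    rw [← hs, ← Category.assoc]
    rfl

theorem isLLDVersion_piecesHom (hK : X.IsGenerating K)
    (hKd : K.Pairwise fun E E' => E ∩ E' ∈ X.negl) (hne : K.Nonempty)
    (hccc : ∀ k (hk : k ∈ K), (X.restrict k (hK.1 k hk)).IsCCC)
    (hcard : Cardinal.mk K ≤ Cardinal.continuum) :
    IsLLDVersion (X.piecesHom K hK.1) :=
  ⟨isLLD_sigma _ fun k => (hccc k k.2).isLLD, fun _ hY q =>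
    existsUnique_lift hK hKd hY.2 (fun q => hY.1.exists_choice hK.1 hKd hne hcard q) q⟩

end pieces

/-! ### Existence and size of the family `K` -/

/-- A locally ccc space has an almost disjointed generating family of ccc sets, whose non-empty
members are not negligible. -/
theorem IsLocallyCCC.exists_family {X : SatMSN.{u}} (hX : X.IsLocallyCCC) :
    ∃ (K : Set (Set X)) (hK : X.IsGenerating K), ∅ ∈ K ∧
      (K.Pairwise fun E E' => E ∩ E' ∈ X.negl) ∧
      (∀ k ∈ K, k ≠ ∅ → k ∉ X.negl) ∧
      ∀ k (hk : k ∈ K), (X.restrict k (hK.1 k hk)).IsCCC := by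
  obtain ⟨M, hMG, hMd, hMm⟩ := X.exists_maximal_almostDisjoint
    {Z | Z ∉ X.negl ∧ ∃ hZ : MeasurableSet Z, (X.restrict Z hZ).IsCCC} fun Z hZ => hZ.1
  -- Adding `∅` keeps the family non-empty even if `M` is empty, so default choices exist.
  have hgen : X.IsGenerating (insert ∅ M) := by
    refine isGenerating_of_inter ?_ fun A hA h => ?_
    · rintro Z (rfl | hZ)
      · exact MeasurableSet.empty
      · exact (hMG hZ).2.1
    · refine IsGenerating.negl_of_inter hX hA fun Z hZ => ?_
      by_contra hcon
      rw [Set.inter_comm] at hcon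
      -- A non-negligible `Z ∩ A` inherits ccc from `Z`, so by maximality it meets some member of
      -- `M` non-negligibly.
      obtain ⟨E, hE, hEZ⟩ := hMm (Z ∩ A) ⟨hcon, hZ.1.inter hA, isCCC_restrict_inter hZ hA⟩
      exact hEZ (X.negl_mono (h E (Or.inr hE)) fun x hx => ⟨hx.2.2, hx.1⟩)
  refine ⟨insert ∅ M, hgen, Set.mem_insert _ _, hMd.insert fun E _ _ => ?_, ?_, ?_⟩
  · simpa using X.empty_negl
  · rintro k (rfl | hk) hne
    · exact absurd rfl hne
    · exact (hMG hk).1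
  · rintro k (rfl | hk)
    · exact isCCC_restrict_empty
    · exact (hMG hk).2.2

/-- An almost disjointed family of non-negligible sets has cardinality at most the continuum if
the space is generated by at most that many ccc sets. -/
theorem mk_le_continuum_of_isGenerating {X : SatMSN.{u}} {E K : Set (Set X)}
    (hE : E ⊆ X.cccSets) (hEg : X.IsGenerating E) (hEc : Cardinal.mk E ≤ Cardinal.continuum)
    (hK : ∀ k ∈ K, MeasurableSet k) (hKd : K.Pairwise fun E E' => E ∩ E' ∈ X.negl)
    (hKn : ∀ k ∈ K, k ≠ ∅ → k ∉ X.negl) : Cardinal.mk K ≤ Cardinal.continuum := by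
  have hsub : K ⊆ {∅} ∪ ⋃ Z ∈ E, {k ∈ K | k ∩ Z ∉ X.negl} := by
    intro k hk
    by_cases hne : k = ∅
    · exact Or.inl hne
    · right
      by_contra hcon
      simp only [Set.mem_iUnion, Set.mem_ofPred_eq, not_exists, not_and, not_not] at hcon
      exact hKn k hk hne (hEg.negl_of_inter (hK k hk) fun Z hZ => hcon Z hZ hk)
  refine (Cardinal.mk_le_mk_of_subset hsub).trans ((Cardinal.mk_union_le _ _).trans ?_)
  refine Cardinal.add_le_of_le Cardinal.aleph0_le_continuum ?_ ?_
  · rw [Cardinal.mk_singleton]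
    exact Cardinal.one_le_aleph0.trans Cardinal.aleph0_le_continuum
  · refine (Cardinal.mk_biUnion_le _ _).trans ?_
    refine Cardinal.mul_le_of_le Cardinal.aleph0_le_continuum hEc (ciSup_le' fun Z => ?_)
    refine le_trans ?_ Cardinal.aleph0_le_continuum
    rw [Cardinal.le_aleph0_iff_set_countable]
    -- The members of `K` meeting `Z` non-negligibly form an almost disjoint family of
    -- non-negligible sets in the ccc restriction to `Z`.
    exact isCCC_restrict_of_mem (hE Z.2) _
      (fun k hk => ⟨(hK k hk.1).inter (hE Z.2).1, hk.2⟩)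
      fun k hk l hl hkl => X.saturated _ _ Set.inter_subset_left (hKd hk.1 hl.1 hkl)

end SatMSN

theorem mainTheorem2 (X : SatMSN.{u}) (hX : X.IsLocallyCCC) :
    (∃ (Xh : SatMSN.{u}) (p : Xh ⟶ X), SatMSN.IsCCCCVersion p) ∧
    (∀ E : Set (Set X), E ⊆ X.cccSets → X.IsGenerating E →
      Cardinal.mk E ≤ Cardinal.continuum →
      (∀ Z ∈ E, MeasurableSpace.CountablySeparated (X.sub Z)) →
      ∃ (Xh : SatMSN.{u}) (p : Xh ⟶ X), SatMSN.IsLLDVersion p ∧ SatMSN.IsCCCCVersion p) := by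
  obtain ⟨K, hK, hmem, hKd, hKn, hccc⟩ := hX.exists_family
  have h := SatMSN.isCCCCVersion_piecesHom hK hKd ⟨∅, hmem⟩ hccc
  -- The same `K` serves both parts; `E` only bounds its cardinality.
  refine ⟨⟨_, _, h⟩, fun E hE hEg hEc _ => ⟨_, _, ?_, h⟩⟩
  exact SatMSN.isLLDVersion_piecesHom hK hKd ⟨∅, hmem⟩ hccc
    (SatMSN.mk_le_continuum_of_isGenerating hE hEg hEc hK.1 hKd hKn)
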